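/- Let $n\ge 1$, let $G=([n],E)$ be a finite simple graph and let $h>0$. For $\sigma\in\{-1,+1\}^n$ put $$H(\sigma)=-\sum_{(i,j)\in E}\sigma_i\sigma_j-h\sum_{i\in[n]}\sigma_i ,$$ and let $\boxminus$ and $\boxplus$ be the all minus and the all plus configuration. For $\beta\ge 0$ consider the Metropolis Glauber dynamics, i.e. the discrete-time Markov chain on $\{-1,+1\}^n$ that moves from $\sigma$ to each $\sigma'$ differing from $\sigma$ in exactly one spin with probability $\frac1n e^{-\beta[H(\sigma')-H(\sigma)]^+}$, where $[a]^+=\max\{a,0\}$, and otherwise stays at $\sigma$. Let $\mathbb P_\eta$ be its law when started from $\eta$ (at inverse temperature $\beta$), and let $\tau_\boxplus$ be the first time (number of steps) at which it visits $\boxplus$. A path from $\sigma$ to $\sigma'$ is a sequence $\omega=(\omega_0=\sigma,\omega_1,\dots,\omega_\ell=\sigma')$, $\ell\ge1$, of configurations in which consecutive ones differ in exactly one spin. The communication height is $$\Phi(\sigma,\sigma')=\min_{\omega:\,\sigma\to\sigma'}\ \max_{0\le k\le \ell}H(\omega_k),$$ the stability level of $\sigma$ is $V_\sigma=\min_{\sigma':H(\sigma')<H(\sigma)}\Phi(\sigma,\sigma')-H(\sigma)$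 (so $V_\boxplus=\infty$), the maximal stability level is $\Gamma=\max_{\sigma\ne\boxplus}V_\sigma$, and the metastable states are the configurations $\eta$ with $V_\eta=\Gamma$. Let $\Gamma_\ell,\Gamma_u\in\mathbb R$ and consider the conditions - **(1)** $\Phi(\boxminus,\boxplus)-H(\boxminus)\ge\Gamma_\ell$; - **(2)** $\Phi(\boxminus,\boxplus)-H(\boxminus)\le\Gamma_u$; - **(3a)** $V_\sigma\le\Gamma_u$ for all $\sigma\notin\{\boxminus,\boxplus\}$; - **(3b)** $V_\sigma<\Gamma_\ell$ for all $\sigma\notin\{\boxminus,\boxplus\}$. **Proposition.** If (1), (2) and (3a) hold, then for all $\varepsilon>0$ $$\lim_{\beta\to\infty}\mathbb P_\boxminus\big[e^{\beta(\Gamma_\ell-\varepsilon)}<\tau_\boxplus<e^{\beta(\Gamma_u+\varepsilon)}\big]=1,$$ and for every metastable state $\eta$ the same holds with $\mathbb P_\boxminus$ replaced by $\mathbb P_\eta$. If, in addition, (3b) holds, then $\boxminus$ is the unique metastable state. -/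

import Mathlib

open MeasureTheory ProbabilityTheory Filter Topology
open scoped NNReal ENNReal

noncomputable section

namespace IsingMetastability

/-- A spin configuration on the vertex set `Fin n`, identified with the set of its plus vertices:
the set `A` stands for the configuration `σ^A` with spins `spin A i`. -/
abbrev Config (n : ℕ) : Type := Finset (Fin n)

/-- The spin at vertex `i`: `+1` if `i ∈ A` and `-1` otherwise. -/
def spin {n : ℕ} (A : Config n) (i : Fin n) : ℝ := if i ∈ A then 1 else -1

/-- The all minus configuration `⊟`. -/
def allMinus (n : ℕ) : Config n := ∅

/-- The all plus configuration `⊞`. -/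
def allPlus (n : ℕ) : Config n := Finset.univ

/-- Two configurations are neighbours if they differ in exactly one spin, `|A ∆ B| = 1`. -/
def Neighbour {n : ℕ} (A B : Config n) : Prop := (symmDiff A B).card = 1

instance {n : ℕ} (A B : Config n) : Decidable (Neighbour A B) :=
  inferInstanceAs (Decidable ((symmDiff A B).card = 1))

section Model

variable {n : ℕ} (G : SimpleGraph (Fin n)) [DecidableRel G.Adj] (h : ℝ)

/-- The Hamiltonian `H(σ) = - ∑_{(i,j) ∈ E} σ_i σ_j - h ∑_i σ_i` (interaction constant `1`). -/
def hamiltonian (A : Config n) : ℝ :=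
  -(∑ e ∈ G.edgeFinset, (e.map (spin A)).mul) - h * ∑ i, spin A i

/-! ### Communication heights, stability levels, metastable states -/

/-- `ω 0, …, ω ℓ` is a path of length `ℓ ≥ 1` from `A` to `B`, flipping one spin in each step. -/
structure IsPath (A B : Config n) (ℓ : ℕ) (ω : ℕ → Config n) : Prop where
  one_le : 1 ≤ ℓ
  start : ω 0 = A
  finish : ω ℓ = B
  step : ∀ k < ℓ, Neighbour (ω k) (ω (k + 1))

/-- The height `max_{0 ≤ k ≤ ℓ} H(ω_k)` of a path `ω 0, …, ω ℓ`. -/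
def pathHeight (ℓ : ℕ) (ω : ℕ → Config n) : ℝ :=
  (Finset.range (ℓ + 1)).sup' Finset.nonempty_range_add_one (fun k => hamiltonian G h (ω k))

/-- The communication height `Φ(A, B)`, the minimal height of a path from `A` to `B`.
(The set of heights is finite, and it is nonempty as soon as `n ≥ 1`, so the infimum is a
minimum.) -/
def commHeight (A B : Config n) : ℝ :=
  sInf {m : ℝ | ∃ (ℓ : ℕ) (ω : ℕ → Config n), IsPath A B ℓ ω ∧ m = pathHeight G h ℓ ω}

/-- The stability level `V_A = min_{B : H(B) < H(A)} Φ(A, B) - H(A)`, with value `∞` if there is no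
configuration of smaller energy. -/
def stabilityLevel (A : Config n) : EReal :=
  ⨅ (B : Config n) (_ : hamiltonian G h B < hamiltonian G h A),
    ((commHeight G h A B - hamiltonian G h A : ℝ) : EReal)

/-- The maximal stability level `Γ = max_{A ≠ ⊞} V_A`. -/
def maxStabilityLevel : EReal :=
  ⨆ (A : Config n) (_ : A ≠ allPlus n), stabilityLevel G h A

/-- The metastable states are the configurations `A` with `V_A = Γ`. -/
def IsMetastable (A : Config n) : Prop := stabilityLevel G h A = maxStabilityLevel G h

/-! ### Metropolis Glauber dynamics -/

/-- The Metropolis probability `(1/n) exp(-β [H(B) - H(A)]^+)` of flipping from `A` to a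
neighbour `B`. -/
def flipProb (β : ℝ≥0) (A B : Config n) : ℝ :=
  1 / n * Real.exp (-β * max (hamiltonian G h B - hamiltonian G h A) 0)

/-- The transition probabilities `c(A, B)` of the dynamics at inverse temperature `β`. -/
def transProb (β : ℝ≥0) (A B : Config n) : ℝ :=
  if Neighbour A B then flipProb G h β A B
  else if A = B then 1 - ∑ C with Neighbour A C, flipProb G h β A C
  else 0

theorem card_neighbours_le (A : Config n) :
    (Finset.univ.filter fun B : Config n => Neighbour A B).card ≤ n := by
  have h1 : (Finset.univ.filter fun B : Config n => Neighbour A B).card ≤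
      (Finset.powersetCard 1 (Finset.univ : Finset (Fin n))).card := by
    apply Finset.card_le_card_of_injOn (fun B => symmDiff A B)
    · intro B hB
      have hB' : Neighbour A B := by simpa using hB
      simpa [Finset.mem_powersetCard, Neighbour] using hB'
    · intro B _ C _ hBC
      exact symmDiff_right_injective A hBC
  simpa using h1

theorem flipProb_nonneg (β : ℝ≥0) (A B : Config n) : 0 ≤ flipProb G h β A B := by
  unfold flipProb; positivity

theorem flipProb_le (β : ℝ≥0) (A B : Config n) : flipProb G h β A B ≤ 1 / n := by
  unfold flipProb
  have h1 : Real.exp (-β * max (hamiltonian G h B - hamiltonian G h A) 0) ≤ 1 := by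
    rw [Real.exp_le_one_iff, neg_mul, neg_nonpos]
    positivity
  have h2 : (0 : ℝ) ≤ 1 / n := by positivity
  exact mul_le_of_le_one_right h2 h1

theorem transProb_nonneg (β : ℝ≥0) (A B : Config n) : 0 ≤ transProb G h β A B := by
  unfold transProb
  split_ifs
  · exact flipProb_nonneg G h β A B
  · have h1 : ∑ C with Neighbour A C, flipProb G h β A C ≤
        ∑ C : Config n with Neighbour A C, (1 / n : ℝ) :=
      Finset.sum_le_sum fun C _ => flipProb_le G h β A C
    rw [Finset.sum_const, nsmul_eq_mul] at h1
    have h2 : ((Finset.univ.filter fun C : Config n => Neighbour A C).card : ℝ) ≤ n := by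
      exact_mod_cast card_neighbours_le A
    have h3 : ((Finset.univ.filter fun C : Config n => Neighbour A C).card : ℝ) * (1 / n) ≤ 1 := by
      rw [mul_one_div]
      exact div_le_one_of_le₀ h2 (by positivity)
    linarith
  · exact le_rfl

theorem transProb_sum (β : ℝ≥0) (A : Config n) : ∑ B, transProb G h β A B = 1 := by
  have hA : ¬ Neighbour A A := by simp [Neighbour]
  have h1 : ∀ B, transProb G h β A B = (if Neighbour A B then flipProb G h β A B else 0) +
      (if A = B then 1 - ∑ C with Neighbour A C, flipProb G h β A C else 0) := by
    intro B
    unfold transProb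
    by_cases hB : Neighbour A B
    · have : A ≠ B := by rintro rfl; exact hA hB
      simp [hB, this]
    · simp [hB]
  simp_rw [h1]
  rw [Finset.sum_add_distrib, Finset.sum_ite_eq, ← Finset.sum_filter]
  simp

/-- One step of the dynamics from `A`, as a probability distribution on configurations. -/
def stepPMF (β : ℝ≥0) (A : Config n) : PMF (Config n) :=
  PMF.ofFintype (fun B => ENNReal.ofReal (transProb G h β A B)) (by
    rw [← ENNReal.ofReal_sum_of_nonneg fun B _ => transProb_nonneg G h β A B,
      transProb_sum, ENNReal.ofReal_one])

instance : MeasurableSingletonClass (Config n) where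
  measurableSet_singleton A := by
    have h1 : ({A} : Set (Config n)) = ⋂ i : Fin n, {B : Config n | i ∈ B ↔ i ∈ A} := by
      ext B
      simp [Finset.ext_iff]
    rw [h1]
    refine MeasurableSet.iInter fun i => ?_
    exact ((measurable_finset_mem i).iff measurable_const).setOf

/-- The transition kernel of the dynamics. -/
def glauberKernel (β : ℝ≥0) : Kernel (Config n) (Config n) :=
  Kernel.ofFunOfCountable fun A => (stepPMF G h β A).toMeasure

instance (β : ℝ≥0) : IsMarkovKernel (glauberKernel G h β) :=
  ⟨fun A => PMF.toMeasure.isProbabilityMeasure (stepPMF G h β A)⟩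

/-- The law `ℙ_A`, on the space of trajectories `ℕ → Config n`, of the discrete time Markov chain
started from `A` whose transition probabilities are `transProb G h β`. -/
def law (β : ℝ≥0) (A : Config n) : Measure (ℕ → Config n) :=
  Kernel.trajMeasure (X := fun _ => Config n) (Measure.dirac A) fun k =>
    (glauberKernel G h β).comap (fun x => x ⟨k, Finset.mem_Iic.2 le_rfl⟩) (measurable_pi_apply _)

end Model

/-- The hitting time `τ_B` of the configuration `B` along a trajectory; it is `∞` if `B` is never
visited. -/
def hittingTime {n : ℕ} (B : Config n) (x : ℕ → Config n) : ℕ∞ :=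
  ⨅ (t : ℕ) (_ : x t = B), (t : ℕ∞)

end IsingMetastability

end

open IsingMetastability

/-!
The proof combines a description of the energy landscape with two bounds on the dynamics, both
resting on the reversibility of the chain with respect to `m(σ) = exp(-β H(σ))`.

*Landscape.* If every `σ ≠ ⊞` has stability level at most `γ`, then `Φ(σ, ⊞) - H(σ) ≤ γ` for every
`σ ≠ ⊞` (`commHeight_allPlus_le`): descend through configurations of smaller and smaller energy and
use the ultrametric inequality for `Φ`. With `γ = Γu` this is the input for the upper bound on the
hitting time. With `γ` just above the maximal stability level it shows that a metastable state has
stability level at least `Φ(⊟, ⊞) - H(⊟) ≥ Γl` (`commHeight_sub_le_stabilityLevel`), hence also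
barrier at least `Γl` towards `⊞`. Uniqueness of the metastable state follows at once, since under
the strict bound no configuration besides `⊟` has so large a stability level.

*The hitting time is not too small* (`law_exists_le`). To reach `⊞` the chain started from `σ` has
to visit a configuration `ξ` with `H(ξ) ≥ Φ(σ, ⊞)`. By reversibility `ξ` is occupied at any given
time with probability at most `m(ξ) / m(σ) ≤ exp(-β (Φ(σ, ⊞) - H(σ)))`, and a union bound over the
times up to `T` suffices.

*The hitting time is not too large* (`exists_law_avoid_le`). The mean hitting time of `⊞` is the sum
over `ξ` of the Green function of the chain killed at `⊞`. By the maximum principle the latter is at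
most its value on the diagonal, and that is at most `m(ξ)` times the resistance between `ξ` and `⊞`
(`truncGreen_diag_le`). A path realizing `Φ(ξ, ⊞)` has edges of conductance at least
`exp(-β Φ(ξ, ⊞)) / n`, so the mean hitting time is at most a constant times `exp(β γ)`, and Markov's
inequality applies. All sums over time are truncated, so that no recurrence has to be shown.
-/

/-! ### Green functions of reversible chains -/

namespace IsingMetastability

section Reversible

variable {α : Type*}

/-- The Dirichlet form of a reversible chain, as a sum over edges. -/
theorem two_mul_dirichlet_form [Fintype α] {P : Matrix α α ℝ} {m : α → ℝ} (hrow : ∀ y, ∑ z, P y z = 1)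
    (hrev : ∀ y z, m y * P y z = m z * P z y) (g : α → ℝ) :
    2 * ∑ y, m y * g y * (g y - ∑ z, P y z * g z) =
      ∑ y, ∑ z, m y * P y z * (g y - g z) ^ 2 := by
  have h1 : ∑ y, ∑ z, m y * P y z * g y ^ 2 = ∑ y, m y * g y ^ 2 := by
    refine Finset.sum_congr rfl fun y _ => ?_
    rw [← Finset.sum_mul, ← Finset.mul_sum, hrow, mul_one]
  have h2 : ∑ y, ∑ z, m y * P y z * g z ^ 2 = ∑ y, m y * g y ^ 2 := by
    rw [Finset.sum_comm, ← h1]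
    exact Finset.sum_congr rfl fun y _ => Finset.sum_congr rfl fun z _ => by rw [hrev]
  have h3 : ∑ y, m y * g y * (g y - ∑ z, P y z * g z) =
      ∑ y, m y * g y ^ 2 - ∑ y, ∑ z, m y * P y z * (g y * g z) := by
    rw [← Finset.sum_sub_distrib]
    refine Finset.sum_congr rfl fun y _ => ?_
    rw [mul_sub, Finset.mul_sum]
    congr 1
    · ring
    · exact Finset.sum_congr rfl fun z _ => by ring
  have h4 : ∑ y, ∑ z, m y * P y z * (g y - g z) ^ 2 =
      ∑ y, ∑ z, m y * P y z * g y ^ 2 + ∑ y, ∑ z, m y * P y z * g z ^ 2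
        - 2 * ∑ y, ∑ z, m y * P y z * (g y * g z) := by
    simp_rw [Finset.mul_sum, ← Finset.sum_add_distrib, ← Finset.sum_sub_distrib]
    exact Finset.sum_congr rfl fun y _ => Finset.sum_congr rfl fun z _ => by ring
  rw [h4, h3, h1, h2]
  ring

variable [DecidableEq α]

/-- The transition matrix `P` killed on `D`: all transitions from or into `D` are removed. -/
def killed (P : Matrix α α ℝ) (D : Finset α) : Matrix α α ℝ :=
  Matrix.of fun y z => if y ∈ D ∨ z ∈ D then 0 else P y z

variable {P : Matrix α α ℝ} {D : Finset α}

theorem killed_nonneg (hP : ∀ y z, 0 ≤ P y z) (y z : α) : 0 ≤ killed P D y z := by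
  simp only [killed, Matrix.of_apply]
  split_ifs
  exacts [le_rfl, hP y z]

theorem killed_le (hP : ∀ y z, 0 ≤ P y z) (y z : α) : killed P D y z ≤ P y z := by
  simp only [killed, Matrix.of_apply]
  split_ifs
  exacts [hP y z, le_rfl]

variable [Fintype α]

theorem killed_pow_nonneg (hP : ∀ y z, 0 ≤ P y z) (t : ℕ) (y z : α) :
    0 ≤ (killed P D ^ t) y z := by
  induction t generalizing y with
  | zero => rw [pow_zero, Matrix.one_apply]; split_ifs <;> norm_num
  | succ t ih =>
    rw [pow_succ', Matrix.mul_apply]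
    exact Finset.sum_nonneg fun w _ => mul_nonneg (killed_nonneg hP y w) (ih w)

theorem killed_pow_le_one (hP : ∀ y z, 0 ≤ P y z) (hrow : ∀ y, ∑ z, P y z = 1) (t : ℕ) (y z : α) :
    (killed P D ^ t) y z ≤ 1 := by
  induction t generalizing y with
  | zero => rw [pow_zero, Matrix.one_apply]; split_ifs <;> norm_num
  | succ t ih =>
    rw [pow_succ', Matrix.mul_apply, ← hrow y]
    refine Finset.sum_le_sum fun w _ => ?_
    exact (mul_le_of_le_one_right (killed_nonneg hP y w) (ih w)).trans (killed_le hP y w)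

theorem killed_pow_reversible {m : α → ℝ} (hrev : ∀ y z, m y * P y z = m z * P z y) (t : ℕ)
    (y z : α) : m y * (killed P D ^ t) y z = m z * (killed P D ^ t) z y := by
  induction t generalizing y z with
  | zero =>
    simp only [pow_zero, Matrix.one_apply]
    by_cases hyz : y = z
    · simp [hyz]
    · simp [hyz, Ne.symm hyz]
  | succ t ih =>
    have hK : ∀ y z, m y * killed P D y z = m z * killed P D z y := by
      intro y z
      simp only [killed, Matrix.of_apply, or_comm (a := z ∈ D)]
      split_ifs
      · simp
      · exact hrev y z
    rw [pow_succ, Matrix.mul_apply, ← pow_succ, pow_succ', Matrix.mul_apply, Finset.mul_sum,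
      Finset.mul_sum]
    refine Finset.sum_congr rfl fun w _ => ?_
    rw [← mul_assoc, ih, mul_right_comm, hK]
    ring

theorem killed_pow_apply_of_mem (t : ℕ) {y x : α} (hy : y ∈ D) (hx : x ∉ D) :
    (killed P D ^ t) y x = 0 := by
  cases t with
  | zero => rw [pow_zero, Matrix.one_apply_ne (ne_of_mem_of_not_mem hy hx)]
  | succ t =>
    rw [pow_succ', Matrix.mul_apply]
    exact Finset.sum_eq_zero fun w _ => by simp [killed, hy]

/-- The Green function of the chain `P` killed on `D`, truncated at time `T`: the expected number
of visits to `x` at times `t < T` before hitting `D`, for the chain started from `y`. -/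
def truncGreen (P : Matrix α α ℝ) (D : Finset α) (T : ℕ) (x y : α) : ℝ :=
  ∑ t ∈ Finset.range T, (killed P D ^ t) y x

theorem truncGreen_nonneg (hP : ∀ y z, 0 ≤ P y z) (T : ℕ) (x y : α) :
    0 ≤ truncGreen P D T x y :=
  Finset.sum_nonneg fun t _ => killed_pow_nonneg hP t y x

theorem truncGreen_succ (T : ℕ) (x y : α) :
    truncGreen P D (T + 1) x y =
      (1 : Matrix α α ℝ) y x + ∑ z, killed P D y z * truncGreen P D T x z := by
  simp only [truncGreen]
  rw [Finset.sum_range_succ', pow_zero, add_comm]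
  congr 1
  simp_rw [Finset.mul_sum, pow_succ', Matrix.mul_apply]
  exact Finset.sum_comm

/-- The maximum principle: the Green function at `x` is largest for the chain started from `x`. -/
theorem truncGreen_le_diag (hP : ∀ y z, 0 ≤ P y z) (hrow : ∀ y, ∑ z, P y z = 1) (T : ℕ) (x y : α) :
    truncGreen P D T x y ≤ truncGreen P D T x x := by
  induction T generalizing y with
  | zero => simp [truncGreen]
  | succ T ih =>
    by_cases hy : y = x
    · rw [hy]
    have hmono : truncGreen P D T x x ≤ truncGreen P D (T + 1) x x := by
      rw [truncGreen, truncGreen, Finset.sum_range_succ]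
      exact le_add_of_nonneg_right (killed_pow_nonneg hP T x x)
    refine le_trans ?_ hmono
    rw [truncGreen_succ, Matrix.one_apply_ne hy, zero_add, ← one_mul (truncGreen P D T x x),
      ← hrow y, Finset.sum_mul]
    exact Finset.sum_le_sum fun z _ =>
      mul_le_mul (killed_le hP y z) (ih z) (truncGreen_nonneg hP T x z) (hP y z)

/-- The Green function has Dirichlet energy at most `m x * g x`, because `(1 - P) g ≤ δ_x` off
the killing set, where `g` vanishes. -/
theorem sum_sq_truncGreen_le {m : α → ℝ} (hm : ∀ y, 0 ≤ m y) (hP : ∀ y z, 0 ≤ P y z)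
    (hrow : ∀ y, ∑ z, P y z = 1) (hrev : ∀ y z, m y * P y z = m z * P z y) (T : ℕ) {x : α}
    (hx : x ∉ D) :
    ∑ y, ∑ z, m y * P y z * (truncGreen P D T x y - truncGreen P D T x z) ^ 2 ≤
      2 * (m x * truncGreen P D T x x) := by
  rw [← two_mul_dirichlet_form hrow hrev]
  refine mul_le_mul_of_nonneg_left ?_ zero_le_two
  have h0 : ∀ y ∈ D, truncGreen P D T x y = 0 := fun y hy =>
    Finset.sum_eq_zero fun t _ => killed_pow_apply_of_mem t hy hx
  calc ∑ y, m y * truncGreen P D T x y * (truncGreen P D T x y - ∑ z, P y z * truncGreen P D T x z)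
      ≤ ∑ y, m y * truncGreen P D T x y * (1 : Matrix α α ℝ) y x := by
        refine Finset.sum_le_sum fun y _ => ?_
        by_cases hy : y ∈ D
        · simp [h0 y hy]
        refine mul_le_mul_of_nonneg_left ?_ (mul_nonneg (hm y) (truncGreen_nonneg hP T x y))
        have h1 : ∑ z, killed P D y z * truncGreen P D T x z =
            ∑ z, P y z * truncGreen P D T x z := by
          refine Finset.sum_congr rfl fun z _ => ?_
          by_cases hz : z ∈ D
          · simp [h0 z hz]
          · simp [killed, hy, hz]
        have h2 := truncGreen_succ (P := P) (D := D) T x y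
        have h3 : truncGreen P D T x y ≤ truncGreen P D (T + 1) x y := by
          rw [truncGreen, truncGreen, Finset.sum_range_succ]
          exact le_add_of_nonneg_right (killed_pow_nonneg hP T y x)
        linarith
    _ = m x * truncGreen P D T x x := by
        simp [Matrix.one_apply]

/-- The resistance bound for the Green function on the diagonal: a path from `x` to the killing set
all of whose edges have conductance at least `c` bounds the expected number of visits to `x`. -/
theorem truncGreen_diag_le {m : α → ℝ} (hm : ∀ y, 0 ≤ m y) (hP : ∀ y z, 0 ≤ P y z)
    (hrow : ∀ y, ∑ z, P y z = 1) (hrev : ∀ y z, m y * P y z = m z * P z y) (T : ℕ) {x : α}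
    (hx : x ∉ D) {c : ℝ} (hc : 0 < c) {l : ℕ} {w : ℕ → α} (hw0 : w 0 = x) (hwl : w l ∈ D)
    (hwc : ∀ k < l, c ≤ m (w k) * P (w k) (w (k + 1))) :
    truncGreen P D T x x ≤ 2 * (l : ℝ) ^ 2 * m x / c := by
  set g := truncGreen P D T x with hg
  have hgx : 0 ≤ g x := truncGreen_nonneg hP T x x
  set E := 2 * (m x * g x) with hE
  have hE0 : 0 ≤ E := mul_nonneg zero_le_two (mul_nonneg (hm x) hgx)
  have hstep : ∀ k < l, g (w k) - g (w (k + 1)) ≤ √(E / c) := by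
    intro k hk
    refine Real.le_sqrt_of_sq_le ((le_div_iff₀ hc).2 ?_)
    have hnn : ∀ y z, 0 ≤ m y * P y z * (g y - g z) ^ 2 := fun y z =>
      mul_nonneg (mul_nonneg (hm y) (hP y z)) (sq_nonneg _)
    calc (g (w k) - g (w (k + 1))) ^ 2 * c
        ≤ m (w k) * P (w k) (w (k + 1)) * (g (w k) - g (w (k + 1))) ^ 2 := by
          rw [mul_comm]
          exact mul_le_mul_of_nonneg_right (hwc k hk) (sq_nonneg _)
      _ ≤ ∑ z, m (w k) * P (w k) z * (g (w k) - g z) ^ 2 :=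
          Finset.single_le_sum (f := fun z => m (w k) * P (w k) z * (g (w k) - g z) ^ 2)
            (fun z _ => hnn _ z) (Finset.mem_univ (w (k + 1)))
      _ ≤ ∑ y, ∑ z, m y * P y z * (g y - g z) ^ 2 :=
          Finset.single_le_sum (f := fun y => ∑ z, m y * P y z * (g y - g z) ^ 2)
            (fun y _ => Finset.sum_nonneg fun z _ => hnn y z) (Finset.mem_univ (w k))
      _ ≤ E := sum_sq_truncGreen_le hm hP hrow hrev T hx
  have hend : g (w l) = 0 :=
    Finset.sum_eq_zero fun t _ => killed_pow_apply_of_mem t hwl hx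
  have htel : g x ≤ l * √(E / c) := by
    have h1 : ∑ k ∈ Finset.range l, (g (w k) - g (w (k + 1))) = g x := by
      rw [Finset.sum_range_sub', hw0, hend, sub_zero]
    rw [← h1]
    refine (Finset.sum_le_card_nsmul _ _ (√(E / c)) fun k hk =>
      hstep k (Finset.mem_range.1 hk)).trans ?_
    simp
  have hsq : g x * g x ≤ (2 * (l : ℝ) ^ 2 * m x / c) * g x := by
    have h1 : g x ^ 2 ≤ (l * √(E / c)) ^ 2 := pow_le_pow_left₀ hgx htel 2
    rw [mul_pow, Real.sq_sqrt (div_nonneg hE0 hc.le), hE] at h1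
    calc g x * g x = g x ^ 2 := by ring
      _ ≤ _ := h1
      _ = _ := by ring
  rcases hgx.eq_or_lt with h0 | h0
  · rw [← h0]
    exact div_nonneg (mul_nonneg (by positivity) (hm x)) hc.le
  · exact le_of_mul_le_mul_right hsq h0

end Reversible

/-! ### The law of the trajectory -/

section Law

variable {n : ℕ} (G : SimpleGraph (Fin n)) [DecidableRel G.Adj] (h : ℝ)

instance (β : ℝ≥0) (A : Config n) : IsProbabilityMeasure (law G h β A) := by
  unfold law
  infer_instance

/-- The transition probabilities of the dynamics, as a matrix. -/
noncomputable def transMatrix (β : ℝ≥0) : Matrix (Config n) (Config n) ℝ :=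
  Matrix.of (transProb G h β)

theorem transMatrix_nonneg (β : ℝ≥0) (A B : Config n) : 0 ≤ transMatrix G h β A B :=
  transProb_nonneg G h β A B

theorem transMatrix_sum (β : ℝ≥0) (A : Config n) : ∑ B, transMatrix G h β A B = 1 :=
  transProb_sum G h β A

theorem glauberKernel_singleton (β : ℝ≥0) (A B : Config n) :
    glauberKernel G h β A {B} = ENNReal.ofReal (transMatrix G h β A B) := by
  change (stepPMF G h β A).toMeasure {B} = _
  rw [PMF.toMeasure_apply_singleton _ _ (measurableSet_singleton B)]
  rfl

theorem map_zero_law (β : ℝ≥0) (A : Config n) :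
    (law G h β A).map (fun x => x 0) = Measure.dirac A := by
  have h1 : (fun x : ℕ → Config n => x 0) =
      (fun x : (Π _ : Finset.Iic 0, Config n) => x ⟨0, Finset.mem_Iic.2 le_rfl⟩) ∘
        Preorder.frestrictLe 0 := rfl
  rw [h1, ← Measure.map_map (measurable_pi_apply _) (by fun_prop), law, Kernel.trajMeasure,
    Measure.map_comp _ _ (by fun_prop), Kernel.traj_map_frestrictLe, Kernel.partialTraj_self,
    Measure.id_comp, Measure.map_map (measurable_pi_apply _) (by fun_prop)]
  exact Measure.map_id

theorem measurableSet_avoid (D : Finset (Config n)) (t : ℕ) :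
    MeasurableSet {x : Π _ : Finset.Iic t, Config n | ∀ s, x s ∉ D} := by
  have h1 : {x : Π _ : Finset.Iic t, Config n | ∀ s, x s ∉ D} =
      ⋂ s, (fun x : Π _ : Finset.Iic t, Config n => x s) ⁻¹' (D : Set (Config n))ᶜ := by
    ext x; simp
  rw [h1]
  exact MeasurableSet.iInter fun s => measurable_pi_apply s D.measurableSet.compl

/-- The entries of the powers of the killed transition matrix are the probabilities of the
trajectories that avoid the killing set. -/
theorem law_avoid_eq_killed_pow (β : ℝ≥0) {A : Config n} {D : Finset (Config n)} (hA : A ∉ D)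
    (t : ℕ) (y : Config n) :
    law G h β A {x | (∀ s ≤ t, x s ∉ D) ∧ x t = y} =
      ENNReal.ofReal ((killed (transMatrix G h β) D ^ t) A y) := by
  induction t generalizing y with
  | zero =>
    have h1 : {x : ℕ → Config n | (∀ s ≤ 0, x s ∉ D) ∧ x 0 = y} =
        (fun x => x 0) ⁻¹' ((D : Set (Config n))ᶜ ∩ {y}) := by
      ext x; simp
    have hmeas : MeasurableSet ((D : Set (Config n))ᶜ ∩ {y}) :=
      D.measurableSet.compl.inter (measurableSet_singleton y)
    rw [h1, ← Measure.map_apply (measurable_pi_apply 0) hmeas, map_zero_law,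
      Measure.dirac_apply' _ hmeas, pow_zero, Matrix.one_apply]
    by_cases hAy : A = y
    · simp [← hAy, hA]
    · simp [hAy]
  | succ t ih =>
    by_cases hy : y ∈ D
    · have h1 : {x : ℕ → Config n | (∀ s ≤ t + 1, x s ∉ D) ∧ x (t + 1) = y} = ∅ := by
        ext x
        simp only [Set.mem_ofPred_eq, Set.mem_empty_iff_false, iff_false, not_and]
        intro hx e
        exact hx (t + 1) le_rfl (e ▸ hy)
      rw [h1, measure_empty, pow_succ, Matrix.mul_apply, Finset.sum_eq_zero, ENNReal.ofReal_zero]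
      intro w _
      simp [killed, hy]
    set S : Set (Π _ : Finset.Iic t, Config n) := {x | ∀ s, x s ∉ D} with hS
    have hSm : MeasurableSet S := measurableSet_avoid D t
    have h1 : {x : ℕ → Config n | (∀ s ≤ t + 1, x s ∉ D) ∧ x (t + 1) = y} =
        (fun x : ℕ → Config n => (Preorder.frestrictLe (π := fun _ => Config n) t x, x (t + 1))) ⁻¹'
          (S ×ˢ {y}) := by
      ext x
      simp only [Set.mem_ofPred_eq, Set.mem_preimage, Set.mem_prod, Set.mem_singleton_iff, hS,
        Subtype.forall, Finset.mem_Iic, Preorder.frestrictLe_apply]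
      refine and_congr_left fun hxy => ⟨fun hx s hs => hx s (by omega), fun hx s hs => ?_⟩
      rcases hs.lt_or_eq with h2 | rfl
      · exact hx s (by omega)
      · rwa [hxy]
    have hpre : Preorder.frestrictLe (π := fun _ => Config n) t ⁻¹' S =
        {x : ℕ → Config n | ∀ s ≤ t, x s ∉ D} := by
      ext x
      simp [hS]
    have hmeas : Measurable
        (fun x : ℕ → Config n =>
          (Preorder.frestrictLe (π := fun _ => Config n) t x, x (t + 1))) := by fun_prop
    have hker : ∀ z : Config n, MeasurableSet {z} := measurableSet_singleton
    rw [h1, ← Measure.map_apply hmeas (hSm.prod (hker y))]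
    have hstep := Kernel.map_frestrictLe_trajMeasure_compProd_eq_map_trajMeasure
      (X := fun _ => Config n) (μ₀ := Measure.dirac A)
      (κ := fun k => (glauberKernel G h β).comap
        (fun x : (Π _ : Finset.Iic k, Config n) => x ⟨k, Finset.mem_Iic.2 le_rfl⟩)
        (measurable_pi_apply _)) (a := t)
    change (law G h β A).map _ ⊗ₘ _ = (law G h β A).map _ at hstep
    rw [← hstep, Measure.compProd_apply_prod hSm (hker y)]
    simp only [Kernel.comap_apply, glauberKernel_singleton]
    have hf : Measurable fun z : Config n => ENNReal.ofReal (transMatrix G h β z y) :=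
      measurable_of_countable _
    have hft : Measurable fun x : (Π _ : Finset.Iic t, Config n) =>
        ENNReal.ofReal (transMatrix G h β (x ⟨t, Finset.mem_Iic.2 le_rfl⟩) y) :=
      hf.comp (measurable_pi_apply _)
    have hfr : Measurable (Preorder.frestrictLe (π := fun _ => Config n) t) := by fun_prop
    rw [setLIntegral_map hSm hft hfr, hpre]
    change ∫⁻ x in {x : ℕ → Config n | ∀ s ≤ t, x s ∉ D},
      ENNReal.ofReal (transMatrix G h β (x t) y) ∂law G h β A = _
    rw [← lintegral_map (f := fun z => ENNReal.ofReal (transMatrix G h β z y)) hf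
      (measurable_pi_apply t), lintegral_fintype, pow_succ, Matrix.mul_apply,
      ENNReal.ofReal_sum_of_nonneg fun w _ => mul_nonneg
        (killed_pow_nonneg (transMatrix_nonneg G h β) t A w)
        (killed_nonneg (transMatrix_nonneg G h β) w y)]
    refine Finset.sum_congr rfl fun w _ => ?_
    rw [Measure.map_apply (measurable_pi_apply t) (hker w),
      Measure.restrict_apply (measurable_pi_apply t (hker w)), Set.inter_comm]
    change _ * law G h β A {x | (∀ s ≤ t, x s ∉ D) ∧ x t = w} = _
    rw [ih, ENNReal.ofReal_mul (killed_pow_nonneg (transMatrix_nonneg G h β) t A w), mul_comm]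
    by_cases hw : w ∈ D
    · rw [← ih]
      have h2 : {x : ℕ → Config n | (∀ s ≤ t, x s ∉ D) ∧ x t = w} = ∅ := by
        ext x
        simp only [Set.mem_ofPred_eq, Set.mem_empty_iff_false, iff_false, not_and]
        intro hx e
        exact hx t le_rfl (e ▸ hw)
      rw [h2, measure_empty, zero_mul, zero_mul]
    · simp [killed, hw, hy]

end Law

/-! ### Communication heights and stability levels -/

section Landscape

variable {n : ℕ}

theorem Neighbour.symm {A B : Config n} (hAB : Neighbour A B) : Neighbour B A := by
  rwa [Neighbour, symmDiff_comm]

theorem IsPath.trans {A B C : Config n} {l₁ l₂ : ℕ} {w₁ w₂ : ℕ → Config n}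
    (h₁ : IsPath A B l₁ w₁) (h₂ : IsPath B C l₂ w₂) :
    IsPath A C (l₁ + l₂) (fun k => if k ≤ l₁ then w₁ k else w₂ (k - l₁)) where
  one_le := h₁.one_le.trans (Nat.le_add_right _ _)
  start := by simpa using h₁.start
  finish := by
    have := h₂.one_le
    rw [if_neg (by omega), Nat.add_sub_cancel_left, h₂.finish]
  step := by
    intro k hk
    rcases lt_trichotomy k l₁ with hkl | rfl | hkl
    · rw [if_pos hkl.le, if_pos (Nat.succ_le_of_lt hkl)]
      exact h₁.step k hkl
    · have := h₂.step 0 (by omega)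
      rw [if_pos le_rfl, if_neg (by omega), h₁.finish, Nat.add_sub_cancel_left, ← h₂.start]
      exact this
    · have := h₂.step (k - l₁) (by omega)
      rw [if_neg (by omega), if_neg (by omega), Nat.sub_add_comm hkl.le]
      exact this

theorem isPath_one {A B : Config n} (hAB : Neighbour A B) :
    IsPath A B 1 (fun k => if k = 0 then A else B) where
  one_le := le_rfl
  start := rfl
  finish := rfl
  step := by
    intro k hk
    obtain rfl : k = 0 := by omega
    exact hAB

theorem neighbour_insert {A : Config n} {i : Fin n} (hi : i ∉ A) : Neighbour A (insert i A) := by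
  have h1 : symmDiff A (insert i A) = {i} := by
    ext j
    simp only [Finset.mem_symmDiff, Finset.mem_insert, Finset.mem_singleton]
    by_cases hj : j = i
    · simp [hj, hi]
    · simp [hj]
  rw [Neighbour, h1, Finset.card_singleton]

/-- Any two configurations, equal or not, are joined by a path of positive length. -/
theorem exists_isPath (hn : 1 ≤ n) (A B : Config n) : ∃ l w, IsPath A B l w := by
  have key : ∀ C : Config n, C ≠ ∅ →
      (∃ l w, IsPath ∅ C l w) ∧ ∃ l w, IsPath C ∅ l w := by
    intro C
    induction C using Finset.induction_on with
    | empty => exact fun hC => absurd rfl hC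
    | insert i C hi ih =>
      intro _
      have hN := neighbour_insert hi
      rcases eq_or_ne C ∅ with rfl | hC
      · exact ⟨⟨_, _, isPath_one hN⟩, ⟨_, _, isPath_one hN.symm⟩⟩
      · obtain ⟨⟨l₁, w₁, h₁⟩, ⟨l₂, w₂, h₂⟩⟩ := ih hC
        exact ⟨⟨_, _, h₁.trans (isPath_one hN)⟩, ⟨_, _, (isPath_one hN.symm).trans h₂⟩⟩
  obtain ⟨⟨l₁, w₁, h₁⟩, ⟨l₂, w₂, h₂⟩⟩ := key {⟨0, hn⟩} (Finset.singleton_ne_empty _)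
  have hto : ∃ l w, IsPath A ∅ l w := by
    rcases eq_or_ne A ∅ with rfl | hA
    · exact ⟨_, _, h₁.trans h₂⟩
    · exact (key A hA).2
  have hfrom : ∃ l w, IsPath ∅ B l w := by
    rcases eq_or_ne B ∅ with rfl | hB
    · exact ⟨_, _, h₁.trans h₂⟩
    · exact (key B hB).1
  obtain ⟨l₃, w₃, h₃⟩ := hto
  obtain ⟨l₄, w₄, h₄⟩ := hfrom
  exact ⟨_, _, h₃.trans h₄⟩

variable (G : SimpleGraph (Fin n)) [DecidableRel G.Adj] (h : ℝ)

theorem finite_pathHeights (A B : Config n) :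
    {m : ℝ | ∃ (l : ℕ) (w : ℕ → Config n), IsPath A B l w ∧ m = pathHeight G h l w}.Finite := by
  refine (Set.finite_range (hamiltonian G h)).subset ?_
  rintro m ⟨l, w, -, rfl⟩
  obtain ⟨k, -, hk⟩ := Finset.exists_mem_eq_sup' Finset.nonempty_range_add_one
    (f := fun k => hamiltonian G h (w k)) (s := Finset.range (l + 1))
  exact ⟨w k, hk.symm⟩

theorem commHeight_le {A B : Config n} {l : ℕ} {w : ℕ → Config n} (hw : IsPath A B l w) {m : ℝ}
    (hm : ∀ k ≤ l, hamiltonian G h (w k) ≤ m) : commHeight G h A B ≤ m := by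
  refine (csInf_le (finite_pathHeights G h A B).bddBelow ⟨l, w, hw, rfl⟩).trans ?_
  exact Finset.sup'_le _ _ fun k hk => hm k (Nat.lt_succ_iff.1 (Finset.mem_range.1 hk))

/-- The infimum defining the communication height is attained. -/
theorem exists_isPath_le_commHeight (hn : 1 ≤ n) (A B : Config n) :
    ∃ l w, IsPath A B l w ∧ ∀ k ≤ l, hamiltonian G h (w k) ≤ commHeight G h A B := by
  obtain ⟨l₀, w₀, h₀⟩ := exists_isPath hn A B
  obtain ⟨l, w, hw, heq⟩ := Set.Nonempty.csInf_mem
    (s := {m : ℝ | ∃ (l : ℕ) (w : ℕ → Config n), IsPath A B l w ∧ m = pathHeight G h l w})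
    ⟨_, l₀, w₀, h₀, rfl⟩ (finite_pathHeights G h A B)
  refine ⟨l, w, hw, fun k hk => ?_⟩
  rw [commHeight, heq]
  exact Finset.le_sup' (fun k => hamiltonian G h (w k)) (Finset.mem_range.2 (Nat.lt_succ_of_le hk))

theorem commHeight_ultrametric (hn : 1 ≤ n) (A B C : Config n) :
    commHeight G h A C ≤ max (commHeight G h A B) (commHeight G h B C) := by
  obtain ⟨l₁, w₁, h₁, hm₁⟩ := exists_isPath_le_commHeight G h hn A B
  obtain ⟨l₂, w₂, h₂, hm₂⟩ := exists_isPath_le_commHeight G h hn B C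
  refine commHeight_le G h (h₁.trans h₂) fun k hk => ?_
  by_cases hkl : k ≤ l₁
  · rw [if_pos hkl]
    exact (hm₁ k hkl).trans (le_max_left _ _)
  · rw [if_neg hkl]
    exact (hm₂ (k - l₁) (by omega)).trans (le_max_right _ _)

theorem hamiltonian_allPlus_lt {h : ℝ} (hh : 0 < h) {A : Config n} (hA : A ≠ allPlus n) :
    hamiltonian G h (allPlus n) < hamiltonian G h A := by
  have hspin : ∀ (B : Config n) (i : Fin n), spin B i = 1 ∨ spin B i = -1 := by
    intro B i
    unfold spin
    split_ifs
    exacts [Or.inl rfl, Or.inr rfl]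
  have hplus : ∀ i, spin (allPlus n) i = 1 := fun i => by simp [spin, allPlus]
  have hedge : ∑ e ∈ G.edgeFinset, (e.map (spin A)).mul ≤
      ∑ e ∈ G.edgeFinset, (e.map (spin (allPlus n))).mul := by
    refine Finset.sum_le_sum fun e _ => ?_
    induction e using Sym2.ind with
    | _ i j =>
      simp only [Sym2.map_mk, Sym2.mul_mk, hplus]
      rcases hspin A i with h1 | h1 <;> rcases hspin A j with h2 | h2 <;> norm_num [h1, h2]
  have hfield : ∑ i, spin A i < ∑ i, spin (allPlus n) i := by
    obtain ⟨i, hi⟩ : ∃ i, i ∉ A := by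
      by_contra hne
      push Not at hne
      exact hA (Finset.eq_univ_iff_forall.2 hne)
    refine Finset.sum_lt_sum (fun j _ => ?_) ⟨i, Finset.mem_univ i, ?_⟩
    · rw [hplus]
      rcases hspin A j with h1 | h1 <;> norm_num [h1]
    · rw [hplus, spin, if_neg hi]
      norm_num
  have := mul_lt_mul_of_pos_left hfield hh
  unfold hamiltonian
  linarith

theorem stabilityLevel_le {A B : Config n} (hBA : hamiltonian G h B < hamiltonian G h A) :
    stabilityLevel G h A ≤ ((commHeight G h A B - hamiltonian G h A : ℝ) : EReal) :=
  iInf₂_le B hBA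

theorem stabilityLevel_allPlus {h : ℝ} (hh : 0 < h) : stabilityLevel G h (allPlus n) = ⊤ := by
  refine iInf₂_eq_top.2 fun B hB => ?_
  rcases eq_or_ne B (allPlus n) with rfl | hne
  · exact absurd hB (lt_irrefl _)
  · exact absurd hB (hamiltonian_allPlus_lt G hh hne).not_gt

theorem exists_commHeight_le_of_stabilityLevel_le {A : Config n} {γ : ℝ}
    (hA : stabilityLevel G h A ≤ (γ : EReal)) :
    ∃ B, hamiltonian G h B < hamiltonian G h A ∧
      commHeight G h A B ≤ hamiltonian G h A + γ := by
  by_contra hne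
  push Not at hne
  -- The infimum over the finitely many lower configurations stays strictly above `γ`.
  have hlt : (γ : EReal) < stabilityLevel G h A := by
    have h1 : stabilityLevel G h A = Finset.univ.inf fun B : Config n =>
        ⨅ _ : hamiltonian G h B < hamiltonian G h A,
          ((commHeight G h A B - hamiltonian G h A : ℝ) : EReal) := by
      rw [stabilityLevel, Finset.inf_univ_eq_iInf]
    rw [h1, Finset.lt_inf_iff (EReal.coe_lt_top γ)]
    intro B _
    by_cases hB : hamiltonian G h B < hamiltonian G h A
    · rw [ciInf_pos hB, EReal.coe_lt_coe_iff]
      linarith [hne B hB]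
    · rw [iInf_neg hB]
      exact EReal.coe_lt_top γ
  exact absurd hA hlt.not_ge

/-- If every configuration other than `⊞` can lower its energy by climbing at most `γ`, then every
configuration can reach `⊞` by climbing at most `γ`: descending repeatedly, each climb starts from a
lower energy than the one before. -/
theorem commHeight_allPlus_le (hn : 1 ≤ n) {γ : ℝ}
    (hγ : ∀ A : Config n, A ≠ allPlus n → stabilityLevel G h A ≤ (γ : EReal))
    (A : Config n) (hA : A ≠ allPlus n) :
    commHeight G h A (allPlus n) ≤ hamiltonian G h A + γ := by
  by_contra hne
  obtain ⟨B, hB, hmin⟩ := Finset.exists_min_image (Finset.univ.filter fun B : Config n =>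
    B ≠ allPlus n ∧ ¬ commHeight G h B (allPlus n) ≤ hamiltonian G h B + γ) (hamiltonian G h)
    ⟨A, by simpa using ⟨hA, not_le.1 hne⟩⟩
  simp only [Finset.mem_filter, Finset.mem_univ, true_and] at hB hmin
  obtain ⟨C, hCB, hC⟩ := exists_commHeight_le_of_stabilityLevel_le G h (hγ B hB.1)
  rcases eq_or_ne C (allPlus n) with rfl | hCp
  · exact hB.2 hC
  have hC' : commHeight G h C (allPlus n) ≤ hamiltonian G h C + γ := by
    by_contra hbad
    exact (hmin C ⟨hCp, hbad⟩).not_gt hCB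
  refine hB.2 ((commHeight_ultrametric G h hn B C (allPlus n)).trans (max_le hC ?_))
  linarith

theorem allMinus_ne_allPlus (hn : 1 ≤ n) : allMinus n ≠ allPlus n := by
  intro e
  have h1 : (⟨0, hn⟩ : Fin n) ∈ allMinus n := by rw [e]; exact Finset.mem_univ _
  simp [allMinus] at h1

/-- The maximal stability level is attained. -/
theorem exists_isMetastable (hn : 1 ≤ n) :
    ∃ A : Config n, A ≠ allPlus n ∧ IsMetastable G h A := by
  obtain ⟨A, hA, hmax⟩ := Finset.exists_max_image
    (Finset.univ.filter fun A : Config n => A ≠ allPlus n) (stabilityLevel G h)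
    ⟨allMinus n, by simpa using allMinus_ne_allPlus hn⟩
  simp only [Finset.mem_filter, Finset.mem_univ, true_and] at hA hmax
  exact ⟨A, hA, le_antisymm (le_iSup₂ (f := fun A _ => stabilityLevel G h A) A hA)
    (iSup₂_le hmax)⟩

theorem IsMetastable.ne_allPlus (hn : 1 ≤ n) {h : ℝ} (hh : 0 < h) {A : Config n}
    (hA : IsMetastable G h A) : A ≠ allPlus n := by
  rintro rfl
  obtain ⟨B, hB, hBmax⟩ := exists_isMetastable G h hn
  have h1 := stabilityLevel_le G h (hamiltonian_allPlus_lt G hh hB)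
  rw [hBmax, ← hA, stabilityLevel_allPlus G hh] at h1
  exact (EReal.coe_lt_top _).not_ge h1

/-- The stability level of a metastable state is at least the barrier from any configuration to
`⊞`. -/
theorem commHeight_sub_le_stabilityLevel (hn : 1 ≤ n) {A η : Config n}
    (hη : IsMetastable G h η) (hA : A ≠ allPlus n) :
    ((commHeight G h A (allPlus n) - hamiltonian G h A : ℝ) : EReal) ≤ stabilityLevel G h η := by
  by_contra hlt
  obtain ⟨γ, hγ₁, hγ₂⟩ := EReal.lt_iff_exists_real_btwn.1 (not_le.1 hlt)
  have h1 := commHeight_allPlus_le G h hn (γ := γ) (fun B hB =>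
    ((le_iSup₂ (f := fun B _ => stabilityLevel G h B) B hB).trans hη.ge).trans hγ₁.le) A hA
  rw [EReal.coe_lt_coe_iff] at hγ₂
  linarith

end Landscape

/-! ### Exponential bounds on the hitting time of `⊞` -/

section Hitting

variable {n : ℕ} (G : SimpleGraph (Fin n)) [DecidableRel G.Adj] (h : ℝ)

theorem exp_mul_transMatrix (β : ℝ≥0) {A B : Config n} (hAB : Neighbour A B) :
    Real.exp (-β * hamiltonian G h A) * transMatrix G h β A B =
      1 / n * Real.exp (-β * max (hamiltonian G h A) (hamiltonian G h B)) := by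
  rw [transMatrix, Matrix.of_apply, transProb, if_pos hAB, flipProb, mul_left_comm, ← Real.exp_add]
  congr 2
  rw [← mul_add, add_comm, ← max_add_add_right, sub_add_cancel, zero_add, max_comm]

theorem transMatrix_reversible (β : ℝ≥0) (A B : Config n) :
    Real.exp (-β * hamiltonian G h A) * transMatrix G h β A B =
      Real.exp (-β * hamiltonian G h B) * transMatrix G h β B A := by
  by_cases hAB : Neighbour A B
  · rw [exp_mul_transMatrix G h β hAB, exp_mul_transMatrix G h β hAB.symm, max_comm]
  rcases eq_or_ne A B with rfl | hne
  · rfl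
  have hBA : ¬ Neighbour B A := fun hBA => hAB hBA.symm
  simp [transMatrix, transProb, hAB, hBA, hne, hne.symm]

theorem neighbour_or_eq_of_transMatrix_ne_zero {β : ℝ≥0} {A B : Config n}
    (hAB : transMatrix G h β A B ≠ 0) : Neighbour A B ∨ A = B := by
  by_contra hne
  push Not at hne
  exact hAB (by simp [transMatrix, transProb, hne.1, hne.2])

/-- A trajectory from `A` that stays below the level `Φ(A, B)` does not reach `B`. -/
theorem killed_pow_apply_eq_zero (β : ℝ≥0) {A B : Config n} {D : Finset (Config n)}
    (hD : ∀ C, C ∉ D → hamiltonian G h C < commHeight G h A B) (hAB : A ≠ B) (t : ℕ) :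
    (killed (transMatrix G h β) D ^ t) A B = 0 := by
  have key : ∀ (t : ℕ) (C : Config n), (killed (transMatrix G h β) D ^ t) A C ≠ 0 →
      A = C ∨ ∃ l w, IsPath A C l w ∧ ∀ k ≤ l, w k ∉ D := by
    intro t
    induction t with
    | zero =>
      intro C hC
      by_contra hne
      push Not at hne
      exact hC (by rw [pow_zero, Matrix.one_apply_ne hne.1])
    | succ t ih =>
      intro C hC
      rw [pow_succ, Matrix.mul_apply] at hC
      obtain ⟨E, -, hE⟩ := Finset.exists_ne_zero_of_sum_ne_zero hC
      have hEC := right_ne_zero_of_mul hE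
      have hmem : E ∉ D ∧ C ∉ D := by
        by_contra hne
        exact hEC (by simp only [killed, Matrix.of_apply]; rw [if_pos (by tauto)])
      have hP : transMatrix G h β E C ≠ 0 := by
        simpa [killed, hmem.1, hmem.2] using hEC
      have hih := ih E (left_ne_zero_of_mul hE)
      rcases neighbour_or_eq_of_transMatrix_ne_zero G h hP with hN | rfl
      · right
        have h1 : ∀ k ≤ 1, (if k = 0 then E else C) ∉ D := by
          intro k _
          split_ifs
          exacts [hmem.1, hmem.2]
        rcases hih with rfl | ⟨l, w, hw, hwD⟩
        · exact ⟨_, _, isPath_one hN, h1⟩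
        · refine ⟨_, _, hw.trans (isPath_one hN), fun k hk => ?_⟩
          by_cases hkl : k ≤ l
          · rw [if_pos hkl]
            exact hwD k hkl
          · rw [if_neg hkl]
            exact h1 (k - l) (by omega)
      · exact hih
  by_contra hne
  rcases key t B hne with e | ⟨l, w, hw, hwD⟩
  · exact hAB e
  · obtain ⟨k, hk, hmax⟩ := Finset.exists_max_image (Finset.range (l + 1))
      (fun k => hamiltonian G h (w k)) Finset.nonempty_range_add_one
    have hle := commHeight_le G h hw (m := hamiltonian G h (w k)) fun j hj =>
      hmax j (Finset.mem_range.2 (Nat.lt_succ_of_le hj))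
    exact (hD _ (hwD k (Nat.lt_succ_iff.1 (Finset.mem_range.1 hk)))).not_ge hle

/-- By reversibility `ℙ_A(X_t = C) ≤ exp(-β (H(C) - H(A)))`. -/
theorem law_apply_eq_le (β : ℝ≥0) (A C : Config n) (t : ℕ) :
    law G h β A {x | x t = C} ≤
      ENNReal.ofReal (Real.exp (-β * (hamiltonian G h C - hamiltonian G h A))) := by
  have h1 := law_avoid_eq_killed_pow G h β (Finset.notMem_empty A) t C
  simp only [Finset.notMem_empty, not_false_eq_true, implies_true, true_and] at h1
  rw [h1]
  refine ENNReal.ofReal_le_ofReal ?_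
  have h2 := killed_pow_reversible (D := ∅) (transMatrix_reversible G h β) t A C
  have h3 : (killed (transMatrix G h β) ∅ ^ t) C A ≤ 1 :=
    killed_pow_le_one (transMatrix_nonneg G h β) (transMatrix_sum G h β) t C A
  have h4 : Real.exp (-β * hamiltonian G h C) =
      Real.exp (-β * hamiltonian G h A) *
        Real.exp (-β * (hamiltonian G h C - hamiltonian G h A)) := by
    rw [← Real.exp_add]
    ring_nf
  refine le_of_mul_le_mul_left ?_ (Real.exp_pos (-β * hamiltonian G h A))
  rw [h2, ← h4]
  exact mul_le_of_le_one_right (Real.exp_pos _).le h3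

/-- Within `T` steps the chain started from `A` reaches `B` with probability at most of order
`T exp(-β (Φ(A, B) - H(A)))`: before that it has to visit the level `Φ(A, B)`. -/
theorem law_exists_le (β : ℝ≥0) {A B : Config n} (hAB : A ≠ B) {γ : ℝ}
    (hγ : γ ≤ commHeight G h A B - hamiltonian G h A) (T : ℕ) :
    law G h β A {x | ∃ s ≤ T, x s = B} ≤
      ENNReal.ofReal ((T + 1) * Fintype.card (Config n) * Real.exp (-β * γ)) := by
  set D : Finset (Config n) :=
    Finset.univ.filter fun C => commHeight G h A B ≤ hamiltonian G h C with hDdef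
  have hD : ∀ C, C ∉ D → hamiltonian G h C < commHeight G h A B := fun C hC => by
    simpa [hDdef] using hC
  have hsub : {x : ℕ → Config n | ∃ s ≤ T, x s = B} ⊆
      (⋃ s ∈ Finset.range (T + 1), {x : ℕ → Config n | (∀ r ≤ s, x r ∉ D) ∧ x s = B}) ∪
        ⋃ s ∈ Finset.range (T + 1), ⋃ C ∈ D, {x : ℕ → Config n | x s = C} := by
    rintro x ⟨s, hs, hxs⟩
    by_cases hx : ∀ r ≤ s, x r ∉ D
    · left
      exact Set.mem_biUnion (Finset.mem_coe.2 (Finset.mem_range.2 (Nat.lt_succ_of_le hs))) ⟨hx, hxs⟩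
    · right
      push Not at hx
      obtain ⟨r, hr, hrD⟩ := hx
      simp only [Set.mem_iUnion]
      exact ⟨r, Finset.mem_range.2 (by omega), x r, hrD, rfl⟩
  have hexp : ∀ C ∈ D, Real.exp (-β * (hamiltonian G h C - hamiltonian G h A)) ≤
      Real.exp (-β * γ) := by
    intro C hC
    have hC' : commHeight G h A B ≤ hamiltonian G h C := by simpa [hDdef] using hC
    refine Real.exp_le_exp.2 (mul_le_mul_of_nonpos_left (by linarith) ?_)
    simp
  by_cases hA : A ∈ D
  · -- If `A` itself has energy `Φ(A, B)`, the right-hand side is at least `1`.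
    refine prob_le_one.trans (ENNReal.one_le_ofReal.2 ?_)
    have h1 := hexp A hA
    rw [sub_self, mul_zero, Real.exp_zero] at h1
    have h2 : (1 : ℝ) ≤ Fintype.card (Config n) := by
      exact_mod_cast Fintype.card_pos
    have h3 : (1 : ℝ) ≤ T + 1 := by simp
    exact one_le_mul_of_one_le_of_one_le (one_le_mul_of_one_le_of_one_le h3 h2) h1
  · have h0 : law G h β A
        (⋃ s ∈ Finset.range (T + 1), {x : ℕ → Config n | (∀ r ≤ s, x r ∉ D) ∧ x s = B}) = 0 := by
      refine (measure_biUnion_null_iff (Finset.countable_toSet _)).2 fun s _ => ?_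
      rw [law_avoid_eq_killed_pow G h β hA, killed_pow_apply_eq_zero G h β hD hAB,
        ENNReal.ofReal_zero]
    refine (measure_mono hsub).trans ((measure_union_le _ _).trans ?_)
    rw [h0, zero_add]
    calc law G h β A (⋃ s ∈ Finset.range (T + 1), ⋃ C ∈ D, {x : ℕ → Config n | x s = C})
        ≤ ∑ s ∈ Finset.range (T + 1), ∑ C ∈ D, law G h β A {x : ℕ → Config n | x s = C} :=
          (measure_biUnion_finset_le _ _).trans
            (Finset.sum_le_sum fun s _ => measure_biUnion_finset_le _ _)
      _ ≤ ∑ s ∈ Finset.range (T + 1), ∑ C ∈ D, ENNReal.ofReal (Real.exp (-β * γ)) :=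
          Finset.sum_le_sum fun s _ => Finset.sum_le_sum fun C hC =>
            (law_apply_eq_le G h β A C s).trans (ENNReal.ofReal_le_ofReal (hexp C hC))
      _ = ENNReal.ofReal ((T + 1) * D.card * Real.exp (-β * γ)) := by
          rw [Finset.sum_const, Finset.sum_const, Finset.card_range, smul_smul, nsmul_eq_mul,
            ENNReal.ofReal_mul (by positivity), ← Nat.cast_add_one, ← Nat.cast_mul,
            ENNReal.ofReal_natCast]
      _ ≤ _ := by
          refine ENNReal.ofReal_le_ofReal ?_
          have : (D.card : ℝ) ≤ Fintype.card (Config n) := by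
            exact_mod_cast Finset.card_le_univ D
          gcongr

/-- The expected number of visits to `y` before `⊞` is at most of order
`exp(β (Φ(y, ⊞) - H(y)))`. -/
theorem exists_truncGreen_le (hn : 1 ≤ n) (y : Config n) (hy : y ≠ allPlus n) {γ : ℝ}
    (hγ : commHeight G h y (allPlus n) ≤ hamiltonian G h y + γ) :
    ∃ K : ℝ, 0 ≤ K ∧ ∀ (β : ℝ≥0) (T : ℕ) (A : Config n),
      truncGreen (transMatrix G h β) {allPlus n} T y A ≤ K * Real.exp (β * γ) := by
  obtain ⟨l, w, hw, hwΦ⟩ := exists_isPath_le_commHeight G h hn y (allPlus n)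
  refine ⟨2 * (l : ℝ) ^ 2 * n, by positivity, fun β T A => ?_⟩
  have hn0 : (0 : ℝ) < n := by exact_mod_cast hn
  have hc : 0 < 1 / (n : ℝ) * Real.exp (-β * (hamiltonian G h y + γ)) := by positivity
  refine (truncGreen_le_diag (transMatrix_nonneg G h β) (transMatrix_sum G h β) T y A).trans ?_
  refine (truncGreen_diag_le (m := fun A => Real.exp (-β * hamiltonian G h A))
    (fun _ => (Real.exp_pos _).le) (transMatrix_nonneg G h β) (transMatrix_sum G h β)
    (transMatrix_reversible G h β) T (by simpa using hy) hc hw.start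
    (by rw [hw.finish]; exact Finset.mem_singleton_self _) fun k hk => ?_).trans_eq ?_
  · rw [exp_mul_transMatrix G h β (hw.step k hk)]
    refine mul_le_mul_of_nonneg_left (Real.exp_le_exp.2 ?_) (by positivity)
    refine mul_le_mul_of_nonpos_left ?_ (by simp)
    exact (max_le (hwΦ k hk.le) (hwΦ (k + 1) hk)).trans hγ
  · have h1 : Real.exp (-β * hamiltonian G h y) =
        Real.exp (β * γ) * Real.exp (-β * (hamiltonian G h y + γ)) := by
      rw [← Real.exp_add]
      ring_nf
    have h2 := (Real.exp_pos (-β * (hamiltonian G h y + γ))).ne'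
    rw [h1]
    field_simp

/-- If every configuration can reach `⊞` by climbing at most `γ`, then the mean hitting time of `⊞`
is at most of order `exp(β γ)`; this is the resulting Markov inequality. -/
theorem exists_law_avoid_le (hn : 1 ≤ n) {γ : ℝ}
    (hγ : ∀ y : Config n, y ≠ allPlus n →
      commHeight G h y (allPlus n) ≤ hamiltonian G h y + γ) :
    ∃ K : ℝ, 0 ≤ K ∧ ∀ (β : ℝ≥0) (T : ℕ) (A : Config n), A ≠ allPlus n →
      law G h β A {x | ∀ s ≤ T, x s ≠ allPlus n} ≤
        ENNReal.ofReal (K * Real.exp (β * γ) / (T + 1)) := by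
  have hK : ∀ y : Config n, ∃ K : ℝ, 0 ≤ K ∧ (y ≠ allPlus n →
      ∀ (β : ℝ≥0) (T : ℕ) (A : Config n),
        truncGreen (transMatrix G h β) {allPlus n} T y A ≤ K * Real.exp (β * γ)) := by
    intro y
    rcases eq_or_ne y (allPlus n) with rfl | hy
    · exact ⟨0, le_rfl, fun hne => absurd rfl hne⟩
    · obtain ⟨K, hK0, hK⟩ := exists_truncGreen_le G h hn y hy (hγ y hy)
      exact ⟨K, hK0, fun _ => hK⟩
  choose K hK0 hK using hK
  refine ⟨∑ y, K y, Finset.sum_nonneg fun y _ => hK0 y, fun β T A hA => ?_⟩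
  set D : Finset (Config n) := {allPlus n} with hD
  have hAD : A ∉ D := by simpa [hD] using hA
  set N : Finset (Config n) := Finset.univ.erase (allPlus n) with hN
  set p := law G h β A {x | ∀ s ≤ T, x s ≠ allPlus n} with hp
  have hstep : ∀ t ∈ Finset.range (T + 1),
      p ≤ ∑ y ∈ N, ENNReal.ofReal ((killed (transMatrix G h β) D ^ t) A y) := by
    intro t ht
    have hsub : {x : ℕ → Config n | ∀ s ≤ T, x s ≠ allPlus n} ⊆
        ⋃ y ∈ N, {x : ℕ → Config n | (∀ s ≤ t, x s ∉ D) ∧ x t = y} := by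
      intro x hx
      have htT : t ≤ T := Nat.lt_succ_iff.1 (Finset.mem_range.1 ht)
      simp only [Set.mem_iUnion]
      refine ⟨x t, Finset.mem_erase.2 ⟨hx t htT, Finset.mem_univ _⟩, fun s hs => ?_, rfl⟩
      simpa [hD] using hx s (hs.trans htT)
    refine (measure_mono hsub).trans ((measure_biUnion_finset_le _ _).trans_eq ?_)
    exact Finset.sum_congr rfl fun y _ => law_avoid_eq_killed_pow G h β hAD t y
  have hnn := fun t y => killed_pow_nonneg (D := D) (transMatrix_nonneg G h β) t A y
  have hsum : ((T + 1 : ℕ) : ℝ≥0∞) * p ≤ ENNReal.ofReal ((∑ y, K y) * Real.exp (β * γ)) := by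
    calc ((T + 1 : ℕ) : ℝ≥0∞) * p = ∑ t ∈ Finset.range (T + 1), p := by
          rw [Finset.sum_const, Finset.card_range, nsmul_eq_mul]
      _ ≤ ∑ t ∈ Finset.range (T + 1), ∑ y ∈ N,
            ENNReal.ofReal ((killed (transMatrix G h β) D ^ t) A y) := Finset.sum_le_sum hstep
      _ = ENNReal.ofReal (∑ y ∈ N, truncGreen (transMatrix G h β) D (T + 1) y A) := by
          rw [Finset.sum_comm, ENNReal.ofReal_sum_of_nonneg fun y _ =>
            truncGreen_nonneg (transMatrix_nonneg G h β) (T + 1) y A]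
          refine Finset.sum_congr rfl fun y _ => ?_
          rw [truncGreen, ENNReal.ofReal_sum_of_nonneg fun t _ => hnn t y]
      _ ≤ ENNReal.ofReal ((∑ y, K y) * Real.exp (β * γ)) := by
          refine ENNReal.ofReal_le_ofReal ?_
          rw [Finset.sum_mul]
          refine (Finset.sum_le_sum fun y hy =>
            hK y (Finset.ne_of_mem_erase hy) β (T + 1) A).trans ?_
          exact Finset.sum_le_sum_of_subset_of_nonneg (Finset.subset_univ _) fun y _ _ =>
            mul_nonneg (hK0 y) (Real.exp_pos _).le
  rw [ENNReal.ofReal_div_of_pos (by positivity), ← Nat.cast_add_one, ENNReal.ofReal_natCast,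
    ENNReal.le_div_iff_mul_le (Or.inl (by simp)) (Or.inl (by simp)), mul_comm]
  exact hsum

/-! ### Concentration of the hitting time on the exponential scale -/

theorem hittingTime_le {B : Config n} {x : ℕ → Config n} {t : ℕ} (ht : x t = B) :
    hittingTime B x ≤ t :=
  iInf₂_le t ht

theorem exists_of_hittingTime_le {B : Config n} {x : ℕ → Config n} {r : ℝ}
    (hr : (hittingTime B x : ℝ≥0∞) ≤ ENNReal.ofReal r) : ∃ s ≤ ⌊r⌋₊, x s = B := by
  by_contra hne
  push Not at hne
  have h1 : ((⌊r⌋₊ + 1 : ℕ) : ℕ∞) ≤ hittingTime B x := by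
    refine le_iInf₂ fun t ht => ?_
    have : ¬ t ≤ ⌊r⌋₊ := fun hle => hne t hle ht
    exact_mod_cast Nat.lt_of_not_le this
  have h2 : (((⌊r⌋₊ + 1 : ℕ) : ℕ∞) : ℝ≥0∞) ≤ ENNReal.ofReal r :=
    (ENat.toENNReal_le.2 h1).trans hr
  rw [ENat.toENNReal_coe, ← ENNReal.ofReal_natCast, ENNReal.ofReal_le_ofReal_iff'] at h2
  have h3 := Nat.lt_floor_add_one r
  push_cast at h2
  rcases h2 with h2 | h2
  · linarith
  · have : (0 : ℝ) ≤ ⌊r⌋₊ := Nat.cast_nonneg _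
    linarith

theorem ne_of_le_hittingTime {B : Config n} {x : ℕ → Config n} {R : ℝ}
    (hR : ENNReal.ofReal R ≤ (hittingTime B x : ℝ≥0∞)) {s : ℕ} (hs : s < ⌈R⌉₊) : x s ≠ B := by
  intro e
  have h1 := hR.trans (ENat.toENNReal_le.2 (hittingTime_le e))
  rw [ENat.toENNReal_coe, ENNReal.ofReal_le_natCast] at h1
  exact (Nat.lt_ceil.1 hs).not_ge h1

theorem tendsto_ofReal_const_mul_exp (K : ℝ) {ε : ℝ} (hε : 0 < ε) :
    Tendsto (fun β : ℝ≥0 => ENNReal.ofReal (K * Real.exp (-β * ε))) atTop (𝓝 0) := by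
  have h1 : Tendsto (fun β : ℝ≥0 => (β : ℝ) * ε) atTop atTop :=
    (NNReal.tendsto_coe_atTop.2 tendsto_id).atTop_mul_const hε
  have h2 := (Real.tendsto_exp_neg_atTop_nhds_zero.comp h1).const_mul K
  rw [mul_zero] at h2
  have h3 := (ENNReal.continuous_ofReal.tendsto 0).comp h2
  rw [ENNReal.ofReal_zero] at h3
  refine h3.congr fun β => ?_
  simp only [Function.comp_apply, neg_mul]

theorem law_hittingTime_le_le (β : ℝ≥0) {A B : Config n} (hAB : A ≠ B) {γ : ℝ}
    (hγ : γ ≤ commHeight G h A B - hamiltonian G h A) (ε : ℝ) :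
    law G h β A {x | (hittingTime B x : ℝ≥0∞) ≤ ENNReal.ofReal (Real.exp (β * (γ - ε)))} ≤
      ENNReal.ofReal (2 * Fintype.card (Config n) * Real.exp (-β * ε)) := by
  set r := Real.exp (β * (γ - ε)) with hr
  have hsub : {x : ℕ → Config n | (hittingTime B x : ℝ≥0∞) ≤ ENNReal.ofReal r} ⊆
      {x | ∃ s ≤ ⌊r⌋₊, x s = B} := fun x hx => exists_of_hittingTime_le hx
  refine (measure_mono hsub).trans ?_
  rcases lt_or_ge r 1 with hr1 | hr1
  · -- A bound below `1` only leaves time `0`, where the chain is still at `A`.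
    have h1 : {x : ℕ → Config n | ∃ s ≤ ⌊r⌋₊, x s = B} = (fun x => x 0) ⁻¹' {B} := by
      rw [Nat.floor_eq_zero.2 hr1]
      ext x
      simp
    rw [h1, ← Measure.map_apply (measurable_pi_apply 0) (measurableSet_singleton B), map_zero_law,
      Measure.dirac_apply' _ (measurableSet_singleton B)]
    simp [hAB]
  · refine (law_exists_le G h β hAB hγ _).trans (ENNReal.ofReal_le_ofReal ?_)
    have h1 : (⌊r⌋₊ : ℝ) + 1 ≤ 2 * r := by
      linarith [Nat.floor_le (zero_le_one.trans hr1)]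
    have h2 : r * Real.exp (-β * γ) = Real.exp (-β * ε) := by
      rw [hr, ← Real.exp_add]
      ring_nf
    calc (⌊r⌋₊ + 1) * Fintype.card (Config n) * Real.exp (-β * γ)
        ≤ 2 * r * Fintype.card (Config n) * Real.exp (-β * γ) := by gcongr
      _ = 2 * Fintype.card (Config n) * (r * Real.exp (-β * γ)) := by ring
      _ = _ := by rw [h2]

theorem tendsto_law_hittingTime (hn : 1 ≤ n) {Γl Γu : ℝ} {A : Config n} (hA : A ≠ allPlus n)
    (hl : Γl ≤ commHeight G h A (allPlus n) - hamiltonian G h A)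
    (hu : ∀ B : Config n, B ≠ allPlus n → stabilityLevel G h B ≤ (Γu : EReal))
    {ε : ℝ} (hε : 0 < ε) :
    Tendsto (fun β : ℝ≥0 => law G h β A
        {x | ENNReal.ofReal (Real.exp (β * (Γl - ε))) < (hittingTime (allPlus n) x : ℝ≥0∞) ∧
            (hittingTime (allPlus n) x : ℝ≥0∞) < ENNReal.ofReal (Real.exp (β * (Γu + ε)))})
        atTop (𝓝 1) := by
  obtain ⟨K, hK0, hK⟩ := exists_law_avoid_le G h hn (commHeight_allPlus_le G h hn hu)
  have hlate : ∀ β : ℝ≥0, law G h β A {x | ENNReal.ofReal (Real.exp (β * (Γu + ε))) ≤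
      (hittingTime (allPlus n) x : ℝ≥0∞)} ≤ ENNReal.ofReal (K * Real.exp (-β * ε)) := by
    intro β
    set R := Real.exp (β * (Γu + ε)) with hR
    have hR0 : 0 < R := Real.exp_pos _
    have hceil : 0 < ⌈R⌉₊ := Nat.ceil_pos.2 hR0
    have hsub : {x : ℕ → Config n | ENNReal.ofReal R ≤ (hittingTime (allPlus n) x : ℝ≥0∞)} ⊆
        {x | ∀ s ≤ ⌈R⌉₊ - 1, x s ≠ allPlus n} :=
      fun x hx s hs => ne_of_le_hittingTime hx (by omega)
    refine (measure_mono hsub).trans ((hK β _ A hA).trans (ENNReal.ofReal_le_ofReal ?_))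
    have h1 : R ≤ ((⌈R⌉₊ - 1 : ℕ) : ℝ) + 1 := by
      rw [← Nat.cast_add_one, Nat.sub_add_cancel hceil]
      exact Nat.le_ceil R
    have h2 : Real.exp (β * Γu) = Real.exp (-β * ε) * R := by
      rw [hR, ← Real.exp_add]
      ring_nf
    refine (div_le_div_of_nonneg_left (by positivity) hR0 h1).trans_eq ?_
    rw [h2, ← mul_assoc, mul_div_cancel_right₀ _ hR0.ne']
  have hlim : Tendsto (fun β : ℝ≥0 =>
      1 - (ENNReal.ofReal (2 * Fintype.card (Config n) * Real.exp (-β * ε)) +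
        ENNReal.ofReal (K * Real.exp (-β * ε)))) atTop (𝓝 1) := by
    have h1 := (tendsto_ofReal_const_mul_exp (2 * Fintype.card (Config n)) hε).add
      (tendsto_ofReal_const_mul_exp K hε)
    have h2 := ENNReal.Tendsto.sub (tendsto_const_nhds (x := (1 : ℝ≥0∞))) h1
      (Or.inl ENNReal.one_ne_top)
    simpa using h2
  refine tendsto_of_tendsto_of_tendsto_of_le_of_le hlim tendsto_const_nhds (fun β => ?_)
    fun β => prob_le_one
  refine tsub_le_iff_right.2 ?_
  rw [← measure_univ (μ := law G h β A)]
  refine le_trans (measure_mono fun x _ => ?_) ((measure_union_le _ _).trans (add_le_add_right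
    ((measure_union_le _ _).trans
      (add_le_add (law_hittingTime_le_le G h β hA hl ε) (hlate β))) _))
  by_cases h1 : ENNReal.ofReal (Real.exp (β * (Γl - ε))) < (hittingTime (allPlus n) x : ℝ≥0∞)
  · by_cases h2 : (hittingTime (allPlus n) x : ℝ≥0∞) < ENNReal.ofReal (Real.exp (β * (Γu + ε)))
    · exact Or.inl ⟨h1, h2⟩
    · exact Or.inr (Or.inr (not_lt.1 h2))
  · exact Or.inr (Or.inl (not_lt.1 h1))

end Hitting

end IsingMetastability

theorem proposition2p3 {n : ℕ} (hn : 1 ≤ n) (G : SimpleGraph (Fin n)) [DecidableRel G.Adj]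
    {h : ℝ} (hh : 0 < h) {Γl Γu : ℝ}
    -- Condition (1)
    (cond1 : Γl ≤ commHeight G h (allMinus n) (allPlus n) - hamiltonian G h (allMinus n))
    -- Condition (2)
    (cond2 : commHeight G h (allMinus n) (allPlus n) - hamiltonian G h (allMinus n) ≤ Γu)
    -- Condition (3a)
    (cond3a : ∀ A : Config n, A ≠ allMinus n → A ≠ allPlus n →
      stabilityLevel G h A ≤ (Γu : EReal)) :
    (∀ ε : ℝ, 0 < ε → Tendsto (fun β : ℝ≥0 => law G h β (allMinus n)
        {x | ENNReal.ofReal (Real.exp (β * (Γl - ε))) < (hittingTime (allPlus n) x : ℝ≥0∞) ∧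
            (hittingTime (allPlus n) x : ℝ≥0∞) < ENNReal.ofReal (Real.exp (β * (Γu + ε)))})
        atTop (𝓝 1)) ∧
    (∀ η : Config n, IsMetastable G h η →
      ∀ ε : ℝ, 0 < ε → Tendsto (fun β : ℝ≥0 => law G h β η
        {x | ENNReal.ofReal (Real.exp (β * (Γl - ε))) < (hittingTime (allPlus n) x : ℝ≥0∞) ∧
            (hittingTime (allPlus n) x : ℝ≥0∞) < ENNReal.ofReal (Real.exp (β * (Γu + ε)))})
        atTop (𝓝 1)) ∧
    -- Condition (3b) implies uniqueness of the metastable state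
    ((∀ A : Config n, A ≠ allMinus n → A ≠ allPlus n → stabilityLevel G h A < (Γl : EReal)) →
      ∀ η : Config n, IsMetastable G h η ↔ η = allMinus n) := by
  have hne := allMinus_ne_allPlus hn
  have hu : ∀ B : Config n, B ≠ allPlus n → stabilityLevel G h B ≤ (Γu : EReal) := by
    intro B hB
    rcases eq_or_ne B (allMinus n) with rfl | hBm
    · exact (stabilityLevel_le G h (hamiltonian_allPlus_lt G hh hne)).trans
        (EReal.coe_le_coe_iff.2 cond2)
    · exact cond3a B hBm hB
  have hl : ∀ η : Config n, IsMetastable G h η → (Γl : EReal) ≤ stabilityLevel G h η :=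
    fun η hη => (EReal.coe_le_coe_iff.2 cond1).trans
      (commHeight_sub_le_stabilityLevel G h hn hη hne)
  refine ⟨fun ε hε => tendsto_law_hittingTime G h hn hne cond1 hu hε, fun η hη ε hε => ?_, ?_⟩
  · have hηp := hη.ne_allPlus G hn hh
    refine tendsto_law_hittingTime G h hn hηp ?_ hu hε
    exact EReal.coe_le_coe_iff.1 ((hl η hη).trans
      (stabilityLevel_le G h (hamiltonian_allPlus_lt G hh hηp)))
  · intro cond3b
    have huniq : ∀ η : Config n, IsMetastable G h η → η = allMinus n := by
      intro η hη
      by_contra hηm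
      exact (cond3b η hηm (hη.ne_allPlus G hn hh)).not_ge (hl η hη)
    refine fun η => ⟨huniq η, ?_⟩
    rintro rfl
    obtain ⟨A, -, hA⟩ := exists_isMetastable G h hn
    rwa [← huniq A hA]
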